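/- Let $\rho\ge 1$, let $\mu$ be a probability measure on $\mathbb R$ with $\int_{\mathbb R}|x|^\rho\,\mu(dx)<+\infty$, and let $N\ge 1$ be an integer. Let $F(x)=\mu((-\infty,x])$, let $F^{-1}(u)=\inf\{x\in\mathbb R:F(x)\ge u\}$ for $u\in(0,1)$, let $F^{-1}(u+)\in[-\infty,+\infty)$ be the right-hand limit of $F^{-1}$ at $u\in[0,1)$ and $F^{-1}(1)=\lim_{u\to1-}F^{-1}(u)\in(-\infty,+\infty]$. Let $\mathcal W_\rho$ be the Wasserstein distance with index $\rho$, i.e. $\mathcal W_\rho(\nu,\eta)=\inf_\pi\big(\int|x-y|^\rho\,\pi(dx,dy)\big)^{1/\rho}$ over all couplings $\pi$ of $\nu$ and $\eta$, and let $$e_N(\mu,\rho)=\inf\Big\{\mathcal W_\rho\Big(\frac1N\sum_{i=1}^N\delta_{x_i},\mu\Big):-\infty<x_1\le\cdots\le x_N<+\infty\Big\}.$$ Then $e_N(\mu,\rho)<+\infty$. For each $i\in\{1,\dots,N\}$ the function $y\mapsto\int_{(i-1)/N}^{i/N}|y-F^{-1}(u)|^\rho\,du$ has a minimizer on $\mathbb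 R$. For every choice of minimizers $x_1^N,\dots,x_N^N$, with $x_i^N$ minimizing the $i$-th function, one has $F^{-1}\big(\frac{i-1}N+\big)\le x_i^N\le F^{-1}\big(\frac iN\big)$ for all $i$, the integrals below converge, and $$e_N^\rho(\mu,\rho)=\rho\sum_{i=1}^N\left(\int_{F^{-1}\left(\frac{i-1}{N}+\right)}^{x_i^N}(x_i^N-y)^{\rho-1}\Big(F(y)-\frac{i-1}{N}\Big)\,dy+\int_{x_i^N}^{F^{-1}\left(\frac{i}{N}\right)}(y-x_i^N)^{\rho-1}\Big(\frac{i}{N}-F(y)\Big)\,dy\right).$$ If $\rho=1$, the points $F^{-1}\big(\frac{2i-1}{2N}\big)$, $1\le i\le N$, are such minimizers, and $$e_N(\mu,1)=\sum_{i=1}^N\left(\int_{F^{-1}\left(\frac{i-1}{N}+\right)}^{F^{-1}\left(\frac{2i-1}{2N}\right)}\Big(F(y)-\frac{i-1}{N}\Big)\,dy+\int_{F^{-1}\left(\frac{2i-1}{2N}\right)}^{F^{-1}\left(\frac{i}{N}\right)}\Big(\frac{i}{N}-F(y)\Big)\,dy\right)=\frac1N\int_{\mathbb R}\min_{j\in\mathbb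 N}|NF(y)-j|\,dy,$$ the last integral being convergent. -/

import Mathlib

open MeasureTheory ProbabilityTheory Set
open scoped ENNReal

noncomputable section

/-- `π` is a coupling of `ν` and `η`: a measure on the plane with these marginals. -/
def IsCoupling (π : Measure (ℝ × ℝ)) (ν η : Measure ℝ) : Prop :=
  π.map Prod.fst = ν ∧ π.map Prod.snd = η

/-- The Wasserstein distance with index `ρ` between two probability measures on the line:
the infimum over all couplings of `(∫ |x - y| ^ ρ dπ(x, y)) ^ (1 / ρ)`. -/
def wasserstein (ρ : ℝ) (ν η : Measure ℝ) : ℝ≥0∞ :=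
  (⨅ (π : Measure (ℝ × ℝ)) (_ : IsCoupling π ν η),
    ∫⁻ z, ENNReal.ofReal (|z.1 - z.2| ^ ρ) ∂π) ^ (1 / ρ)

/-- The empirical measure `(1 / N) ∑ δ_{x_i}`. -/
def empirical {N : ℕ} (x : Fin N → ℝ) : Measure ℝ :=
  (N : ℝ≥0∞)⁻¹ • ∑ i, Measure.dirac (x i)

/-- `e_N(μ, ρ)`: the minimal Wasserstein distance between `μ` and the empirical measure of
`N` ordered points. -/
def minError (N : ℕ) (μ : Measure ℝ) (ρ : ℝ) : ℝ≥0∞ :=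
  ⨅ (x : Fin N → ℝ) (_ : Monotone x), wasserstein ρ (empirical x) μ

/-- The quantile function `F⁻¹(u) = inf {x | u ≤ F x}`, for `u ∈ (0, 1)`. -/
def quantile (μ : Measure ℝ) (u : ℝ) : ℝ := sInf {x : ℝ | u ≤ cdf μ x}

/-- The right-hand limit `F⁻¹(u+) ∈ [-∞, +∞)` at `u ∈ [0, 1)`. As the quantile function is
non-decreasing on `(0, 1)`, it is the infimum of the values on `(u, 1)`. -/
def quantileRight (μ : Measure ℝ) (u : ℝ) : EReal :=
  ⨅ v ∈ Ioo u 1, (quantile μ v : EReal)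

/-- The value `F⁻¹(u) ∈ (-∞, +∞]` for `u ∈ (0, 1]`, where `F⁻¹(1)` is the left-hand limit of
the quantile function at `1`, that is, the supremum of its values on `(0, 1)`. -/
def quantileExt (μ : Measure ℝ) (u : ℝ) : EReal :=
  if u < 1 then (quantile μ u : EReal) else ⨆ v ∈ Ioo (0 : ℝ) 1, (quantile μ v : EReal)

/-- The cost `∫_{i/N}^{(i+1)/N} |y - F⁻¹(u)| ^ ρ du` of the point `y` on the cell with
(zero-based) index `i`. -/
def cellCost (μ : Measure ℝ) (ρ : ℝ) (N i : ℕ) (y : ℝ) : ℝ≥0∞ :=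
  ∫⁻ u in Ioo ((i : ℝ) / N) (((i : ℝ) + 1) / N), ENNReal.ofReal (|y - quantile μ u| ^ ρ)

/-- `x` lists optimal points: `x i` minimizes the cost on the `i`-th cell, for every `i`. -/
def IsOptimal (μ : Measure ℝ) (ρ : ℝ) {N : ℕ} (x : Fin N → ℝ) : Prop :=
  ∀ (i : Fin N) (y : ℝ), cellCost μ ρ N i (x i) ≤ cellCost μ ρ N i y

/-- The part `{y | F⁻¹((i/N)+) ≤ y ≤ t}` of the `i`-th (zero-based) quantile cell. -/
def lowerCell (μ : Measure ℝ) (N i : ℕ) (t : ℝ) : Set ℝ :=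
  {y : ℝ | quantileRight μ ((i : ℝ) / N) ≤ (y : EReal) ∧ y ≤ t}

/-- The part `{y | t ≤ y ≤ F⁻¹((i+1)/N)}` of the `i`-th (zero-based) quantile cell. -/
def upperCell (μ : Measure ℝ) (N i : ℕ) (t : ℝ) : Set ℝ :=
  {y : ℝ | t ≤ y ∧ (y : EReal) ≤ quantileExt μ (((i : ℝ) + 1) / N)}

/-- The median points `F⁻¹((2i+1)/(2N))` (zero-based) of the cells. -/
def medianPoints (μ : Measure ℝ) (N : ℕ) (i : Fin N) : ℝ :=
  quantile μ ((2 * ((i : ℕ) : ℝ) + 1) / (2 * N))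

end

/-! ### Quantile function: Galois connection with the distribution function, and transport of
Lebesgue measure. -/

section QuantileFunction

open Filter Topology

variable (μ : Measure ℝ)

/-! The quantile function pushes Lebesgue measure on (0,1) forward to `μ`. Sending the i-th cell of
levels, of length 1/N, to the point `x i` therefore gives a coupling of the empirical measure with
`μ`. For ordered points this coupling is optimal: `|x - y| ^ ρ` is a convex function of `x - y`,
hence has the Monge property, which yields explicit dual potentials (`exists_potential`); weak
duality concludes (`wasserstein_empirical`).

The transport cost is thus a sum of cell costs, each depending on a single point, so the
minimization decouples. A minimizer lies in its quantile cell (`mem_cell_of_isMin`), so optimal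
points are automatically ordered and `minError_eq` follows. The layer-cake formula rewrites each
cell cost through F (`lintegral_cost_quantile`, `cellCost_formula`).

For ρ = 1 medians are optimal, and each cell cost integrates a tent function of F; the N tents add
up to the distance from NF to the integers, divided by N. -/

theorem quantile_le_iff {u : ℝ} (hu : u ∈ Ioo (0 : ℝ) 1) (y : ℝ) :
    quantile μ u ≤ y ↔ u ≤ cdf μ y := by
  have hne : {x : ℝ | u ≤ cdf μ x}.Nonempty := by
    obtain ⟨x, hx⟩ := ((tendsto_cdf_atTop μ).eventually (lt_mem_nhds hu.2)).exists
    exact ⟨x, hx.le⟩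
  have hbdd : BddBelow {x : ℝ | u ≤ cdf μ x} := by
    obtain ⟨x, hx⟩ := ((tendsto_cdf_atBot μ).eventually (gt_mem_nhds hu.1)).exists
    refine ⟨x, fun z hz => le_of_not_gt fun hzx => ?_⟩
    have := monotone_cdf μ hzx.le
    have hz' : u ≤ cdf μ z := hz
    linarith
  refine ⟨fun h => ?_, fun h => csInf_le hbdd h⟩
  -- The infimum is attained by right-continuity: every z > y satisfies u ≤ F(z), and z decreases to
  -- y.
  have hcont : Tendsto (cdf μ) (𝓝[>] y) (𝓝 (cdf μ y)) :=
    ((cdf μ).right_continuous y).mono_left (nhdsWithin_mono _ Ioi_subset_Ici_self)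
  refine ge_of_tendsto hcont ?_
  filter_upwards [self_mem_nhdsWithin] with z hz
  obtain ⟨x, hx, hxz⟩ := exists_lt_of_csInf_lt hne (lt_of_le_of_lt h hz)
  exact le_trans hx (monotone_cdf μ hxz.le)

theorem lt_quantile_iff {u : ℝ} (hu : u ∈ Ioo (0 : ℝ) 1) (y : ℝ) :
    y < quantile μ u ↔ cdf μ y < u := by
  rw [← not_le, quantile_le_iff μ hu, not_le]

theorem monotoneOn_quantile : MonotoneOn (quantile μ) (Ioo 0 1) := fun _ hu _ hv huv =>
  (quantile_le_iff μ hu _).2 (huv.trans ((quantile_le_iff μ hv _).1 le_rfl))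

theorem measurable_quantile : Measurable (quantile μ) := by
  -- Outside (0,1] the `sInf` is over the whole line or the empty set, with default value 0. The
  -- level 1 fits neither case and is treated as a singleton.
  have h0 : ∀ u : ℝ, u ∉ Ioo (0 : ℝ) 1 → u ≠ 1 → quantile μ u = 0 := by
    intro u hu hu1
    unfold quantile
    rcases le_or_gt u 0 with h | h
    · have : {x : ℝ | u ≤ cdf μ x} = univ :=
        eq_univ_of_forall fun x => h.trans (cdf_nonneg μ x)
      rw [this, Real.sInf_univ]
    · have h1 : 1 < u := lt_of_le_of_ne (not_lt.1 fun h' => hu ⟨h, h'⟩) hu1.symm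
      have : {x : ℝ | u ≤ cdf μ x} = ∅ :=
        eq_empty_of_forall_notMem fun x hx => absurd (cdf_le_one μ x) (not_le.2 (h1.trans_le hx))
      rw [this, Real.sInf_empty]
  refine measurable_of_Iic fun y => ?_
  have : quantile μ ⁻¹' Iic y = (Ioo 0 1 ∩ Iic (cdf μ y)) ∪ ({1} ∩ {_u | quantile μ 1 ≤ y}) ∪
      ((Ioo 0 1 ∪ {1})ᶜ ∩ {_u | 0 ≤ y}) := by
    ext u
    by_cases hu : u ∈ Ioo (0 : ℝ) 1
    · have hu1 : u ≠ 1 := hu.2.ne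
      have := quantile_le_iff μ hu y
      simp only [mem_preimage, mem_Iic, mem_union, mem_inter_iff, hu, hu1, this, mem_singleton_iff,
        mem_compl_iff]
      simp
    · by_cases hu1 : u = 1
      · subst hu1; simp
      · simp only [mem_preimage, mem_Iic, mem_union, mem_inter_iff, hu, hu1, mem_singleton_iff,
          mem_compl_iff, h0 u hu hu1]
        simp
  rw [this]
  refine ((measurableSet_Ioo.inter measurableSet_Iic).union
    ((measurableSet_singleton _).inter (.const _))).union
    ((measurableSet_Ioo.union (measurableSet_singleton _)).compl.inter (.const _))

theorem volume_Ioo_inter_quantile_le {a b : ℝ} (ha : 0 ≤ a) (hb : b ≤ 1) (y : ℝ) :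
    volume.restrict (Ioo a b) {u | quantile μ u ≤ y} = ENNReal.ofReal (min b (cdf μ y) - a) := by
  rw [Measure.restrict_apply (measurableSet_le (measurable_quantile μ) measurable_const)]
  have : {u | quantile μ u ≤ y} ∩ Ioo a b = Ioo a b ∩ Iic (cdf μ y) := by
    ext u
    simp only [mem_inter_iff, mem_ofPred_eq, mem_Iic, and_comm (a := u ∈ Ioo a b)]
    refine and_congr_left fun hu => quantile_le_iff μ ⟨ha.trans_lt hu.1, hu.2.trans_le hb⟩ y
  have hae : (Ioo a b ∩ Iic (cdf μ y) : Set ℝ) =ᵐ[volume] (Ioc a b ∩ Iic (cdf μ y) : Set ℝ) :=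
    Ioo_ae_eq_Ioc.inter (ae_eq_refl _)
  rw [this, measure_congr hae, Ioc_inter_Iic, Real.volume_Ioc]

theorem volume_Ioo_inter_lt_quantile {a b : ℝ} (ha : 0 ≤ a) (hb : b ≤ 1) (y : ℝ) :
    volume.restrict (Ioo a b) {u | y < quantile μ u} = ENNReal.ofReal (b - max a (cdf μ y)) := by
  rw [Measure.restrict_apply (measurableSet_lt measurable_const (measurable_quantile μ))]
  have : {u | y < quantile μ u} ∩ Ioo a b = Ioo a b ∩ Ioi (cdf μ y) := by
    ext u
    simp only [mem_inter_iff, mem_ofPred_eq, mem_Ioi, and_comm (a := u ∈ Ioo a b)]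
    refine and_congr_left fun hu => lt_quantile_iff μ ⟨ha.trans_lt hu.1, hu.2.trans_le hb⟩ y
  rw [this, Ioo_inter_Ioi, Real.volume_Ioo]

theorem map_quantile [IsProbabilityMeasure μ] : (volume.restrict (Ioo (0 : ℝ) 1)).map (quantile μ) = μ := by
  have : IsProbabilityMeasure ((volume.restrict (Ioo (0 : ℝ) 1)).map (quantile μ)) := by
    constructor
    rw [Measure.map_apply (measurable_quantile μ) .univ]
    simp
  refine Measure.ext_of_Iic _ _ fun y => ?_
  rw [Measure.map_apply (measurable_quantile μ) measurableSet_Iic, ← ofReal_cdf]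
  refine (volume_Ioo_inter_quantile_le μ le_rfl le_rfl y).trans ?_
  rw [min_eq_right (cdf_le_one μ y), sub_zero]

end QuantileFunction

/-! ### Partition of (0,1) into N cells of equal length. -/

section UniformCells

theorem restrict_Ioo_eq_sum_cells {N : ℕ} (hN : 1 ≤ N) :
    (volume.restrict (Ioo (0 : ℝ) 1)) =
      ∑ i : Fin N, volume.restrict (Ioo (((i : ℕ) : ℝ) / N) ((((i : ℕ) : ℝ) + 1) / N)) := by
  have hN0 : (0 : ℝ) < N := by exact_mod_cast hN
  -- Half-open intervals tile exactly, which allows induction; endpoints are null.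
  have key : ∀ n : ℕ, (volume.restrict (Ioc (0 : ℝ) ((n : ℝ) / N))) =
      ∑ i ∈ Finset.range n, volume.restrict (Ioc ((i : ℝ) / N) (((i : ℝ) + 1) / N)) := by
    intro n
    induction n with
    | zero => simp
    | succ n ih =>
      rw [Finset.sum_range_succ, ← ih, ← Measure.restrict_union (Ioc_disjoint_Ioc_of_le le_rfl)
        measurableSet_Ioc, Ioc_union_Ioc_eq_Ioc (by positivity) (by gcongr; linarith)]
      push_cast
      rfl
  have h := key N
  rw [div_self hN0.ne'] at h
  rw [Measure.restrict_congr_set Ioo_ae_eq_Ioc, h, ← Fin.sum_univ_eq_sum_range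
    (fun i : ℕ => volume.restrict (Ioc ((i : ℝ) / N) (((i : ℝ) + 1) / N)))]
  exact Finset.sum_congr rfl fun i _ => (Measure.restrict_congr_set Ioo_ae_eq_Ioc).symm

theorem cell_bounds {N : ℕ} (i : Fin N) :
    0 ≤ ((i : ℕ) : ℝ) / N ∧ ((i : ℕ) : ℝ) / N < (((i : ℕ) : ℝ) + 1) / N ∧
      (((i : ℕ) : ℝ) + 1) / N ≤ 1 := by
  have hN0 : (0 : ℝ) < N := by exact_mod_cast i.pos
  have : ((i : ℕ) : ℝ) + 1 ≤ N := by exact_mod_cast i.2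
  refine ⟨by positivity, by gcongr; linarith, (div_le_one hN0).2 this⟩

theorem cell_subset {N : ℕ} (i : Fin N) :
    Ioo (((i : ℕ) : ℝ) / N) ((((i : ℕ) : ℝ) + 1) / N) ⊆ Ioo (0 : ℝ) 1 :=
  Ioo_subset_Ioo (cell_bounds i).1 (cell_bounds i).2.2

theorem volume_cell {N : ℕ} (i : Fin N) :
    volume (Ioo (((i : ℕ) : ℝ) / N) ((((i : ℕ) : ℝ) + 1) / N)) = (N : ℝ≥0∞)⁻¹ := by
  have hN0 : (0 : ℝ) < N := by exact_mod_cast i.pos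
  rw [Real.volume_Ioo, ← sub_div, add_sub_cancel_left, one_div, ENNReal.ofReal_inv_of_pos hN0,
    ENNReal.ofReal_natCast]

end UniformCells

/-! ### Convexity of the cost and the Monge inequality. -/

section Monge

/-- Both q and r are convex combinations of p and s, with the two weights exchanged; adding the two
convexity inequalities gives the claim. -/
theorem ConvexOn.add_le_add_of_mem_Icc {f : ℝ → ℝ} (hf : ConvexOn ℝ univ f) {p q r s : ℝ}
    (hpq : p ≤ q) (hqs : q ≤ s) (h : p + s = q + r) : f q + f r ≤ f p + f s := by
  rcases eq_or_lt_of_le (hpq.trans hqs) with hps | hps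
  · have h1 : q = p := by linarith
    have h2 : r = s := by linarith
    rw [h1, h2]
  · have hd : 0 < s - p := sub_pos.2 hps
    have hc : (s - q) / (s - p) + (q - p) / (s - p) = 1 := by field_simp; ring
    have h0 : 0 ≤ (s - q) / (s - p) := div_nonneg (by linarith) hd.le
    have h1 : 0 ≤ (q - p) / (s - p) := div_nonneg (by linarith) hd.le
    have e1 := hf.2 (mem_univ p) (mem_univ s) h0 h1 hc
    have e2 := hf.2 (mem_univ s) (mem_univ p) h0 h1 hc
    have eq1 : (s - q) / (s - p) * p + (q - p) / (s - p) * s = q := by field_simp; ring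
    have eq2 : (s - q) / (s - p) * s + (q - p) / (s - p) * p = r := by
      have : r = p + s - q := by linarith
      rw [this]; field_simp; ring
    simp only [smul_eq_mul] at e1 e2
    rw [eq1] at e1
    rw [eq2] at e2
    calc f q + f r ≤ ((s - q) / (s - p) + (q - p) / (s - p)) * (f p + f s) := by linarith
      _ = f p + f s := by rw [hc, one_mul]

theorem convexOn_abs_rpow {ρ : ℝ} (hρ : 1 ≤ ρ) : ConvexOn ℝ univ fun x : ℝ => |x| ^ ρ := by
  have h1 : ConvexOn ℝ univ fun x : ℝ => |x| := convexOn_norm convex_univ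
  refine ⟨convex_univ, fun x _ y _ a b ha hb hab => ?_⟩
  refine (Real.rpow_le_rpow (abs_nonneg _) (h1.2 (mem_univ x) (mem_univ y) ha hb hab)
    (by linarith)).trans ?_
  exact (convexOn_rpow hρ).2 (abs_nonneg x) (abs_nonneg y) ha hb hab

/-- The Monge property of the cost `|x - y| ^ ρ`. -/
theorem abs_sub_rpow_monge {ρ : ℝ} (hρ : 1 ≤ ρ) {x x' y y' : ℝ} (hx : x ≤ x') (hy : y ≤ y') :
    |x - y| ^ ρ + |x' - y'| ^ ρ ≤ |x - y'| ^ ρ + |x' - y| ^ ρ :=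
  (convexOn_abs_rpow hρ).add_le_add_of_mem_Icc (p := x - y') (s := x' - y)
    (by linarith) (by linarith) (by ring)

end Monge

/-! ### Optimality of the quantile coupling by duality. -/

section OptimalTransport

/-- Dual potentials for the transport of ordered points to the quantile cells. -/
theorem exists_potential (μ : Measure ℝ) {ρ : ℝ} (hρ : 1 ≤ ρ) {N : ℕ} (x : Fin N → ℝ)
    (hx : Monotone x) :
    ∃ a : Fin N → ℝ, (∀ i, 0 ≤ a i) ∧ ∀ i : Fin N,
      ∀ u ∈ Ioo (((i : ℕ) : ℝ) / N) ((((i : ℕ) : ℝ) + 1) / N), ∀ k : Fin N,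
        |x i - quantile μ u| ^ ρ + a i ≤ |x k - quantile μ u| ^ ρ + a k := by
  rcases Nat.eq_zero_or_pos N with rfl | hN
  · exact ⟨fun _ => 0, fun i => i.elim0, fun i => i.elim0⟩
  have hN0 : (0 : ℝ) < N := by exact_mod_cast hN
  -- Clamping the index extends the points to all naturals, so that `X (j + 1)` always makes sense.
  let X : ℕ → ℝ := fun k => x ⟨min k (N - 1), by omega⟩
  have hXmono : Monotone X := fun k l hkl => hx (by
    rw [Fin.mk_le_mk]; exact min_le_min_right _ hkl)
  have hXx : ∀ i : Fin N, X i = x i := fun i => by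
    have : min (i : ℕ) (N - 1) = i := min_eq_left (by omega)
    simp only [X, this]
  let b : ℕ → ℝ := fun k => quantile μ (((k : ℝ) + 1) / N)
  -- Chosen so that points k and k + 1 tie at the common boundary `b k` of their cells. By Monge,
  -- quantile values below `b k` then prefer k, and those above prefer k + 1.
  let s : ℕ → ℝ := fun k =>
    ∑ j ∈ Finset.range k, (|X j - b j| ^ ρ - |X (j + 1) - b j| ^ ρ)
  have hs : ∀ k, s (k + 1) = s k + (|X k - b k| ^ ρ - |X (k + 1) - b k| ^ ρ) := fun k =>
    Finset.sum_range_succ _ _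
  -- Adding a constant to all potentials changes nothing; nonnegativity lets them pass to `ℝ≥0∞`
  -- without truncation.
  obtain ⟨C, hC⟩ : ∃ C, ∀ i : Fin N, -s i ≤ C := by
    obtain ⟨C, hC⟩ := (Set.finite_range fun i : Fin N => -s i).bddAbove
    exact ⟨C, fun i => hC ⟨i, rfl⟩⟩
  refine ⟨fun i => s i + C, fun i => by linarith [hC i], fun i u hu k => ?_⟩
  have hu01 := cell_subset i hu
  rw [← hXx i, ← hXx k]
  suffices h : |X i - quantile μ u| ^ ρ + s i ≤ |X k - quantile μ u| ^ ρ + s k by linarith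
  rcases le_total (i : ℕ) k with hik | hki
  · have key : ∀ l, (i : ℕ) ≤ l → l < N →
        |X i - quantile μ u| ^ ρ + s i ≤ |X l - quantile μ u| ^ ρ + s l := by
      intro l hl
      induction l, hl using Nat.le_induction with
      | base => exact fun _ => le_rfl
      | succ l hl ih =>
        intro hlN
        have hl1 : ((l : ℝ) + 1) < N := by exact_mod_cast hlN
        have hil : ((i : ℕ) : ℝ) ≤ l := by exact_mod_cast hl
        have hb : quantile μ u ≤ b l := monotoneOn_quantile μ hu01
          ⟨by positivity, (div_lt_one hN0).2 hl1⟩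
          (hu.2.le.trans (by gcongr))
        have := abs_sub_rpow_monge hρ (hXmono (Nat.le_succ l)) hb
        have := ih (by omega)
        rw [hs]
        simp only [Nat.succ_eq_add_one] at *
        linarith
    exact key k hik k.2
  · have key : ∀ m l, l + m = (i : ℕ) →
        |X i - quantile μ u| ^ ρ + s i ≤ |X l - quantile μ u| ^ ρ + s l := by
      intro m
      induction m with
      | zero => intro l hl; rw [← hl]; exact le_rfl
      | succ m ih =>
        intro l hl
        have hil : (l : ℝ) + 1 ≤ ((i : ℕ) : ℝ) := by
          have : l + 1 ≤ (i : ℕ) := by omega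
          exact_mod_cast this
        have hiN : ((i : ℕ) : ℝ) < N := by exact_mod_cast i.2
        have hb : b l ≤ quantile μ u := monotoneOn_quantile μ
          ⟨by positivity, (div_lt_one hN0).2 (by linarith)⟩ hu01
          (le_trans (by gcongr) hu.1.le)
        have := abs_sub_rpow_monge hρ (hXmono (Nat.le_succ l)) hb
        have := ih (l + 1) (by omega)
        rw [hs] at this
        simp only [Nat.succ_eq_add_one] at *
        linarith
    exact key (i - k) k (by omega)

variable (μ : Measure ℝ) [IsProbabilityMeasure μ]

theorem lintegral_eq_sum_cells {N : ℕ} (hN : 1 ≤ N) {g : ℝ → ℝ≥0∞} (hg : Measurable g) :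
    ∫⁻ y, g y ∂μ =
      ∑ i : Fin N, ∫⁻ u in Ioo (((i : ℕ) : ℝ) / N) ((((i : ℕ) : ℝ) + 1) / N),
        g (quantile μ u) := by
  conv_lhs => rw [← map_quantile μ]
  rw [lintegral_map hg (measurable_quantile μ), restrict_Ioo_eq_sum_cells hN,
    lintegral_finsetSum_measure]

theorem lintegral_empirical {N : ℕ} (x : Fin N → ℝ) {g : ℝ → ℝ≥0∞} (hg : Measurable g) :
    ∫⁻ y, g y ∂(empirical x) = (N : ℝ≥0∞)⁻¹ * ∑ i, g (x i) := by
  rw [empirical, lintegral_smul_measure, lintegral_finsetSum_measure, smul_eq_mul]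
  simp only [lintegral_dirac' _ hg]

theorem measurable_cost (ρ s : ℝ) : Measurable fun y : ℝ => ENNReal.ofReal (|s - y| ^ ρ) := by
  fun_prop

theorem isCoupling_cells {N : ℕ} (hN : 1 ≤ N) (x : Fin N → ℝ) :
    IsCoupling (∑ i : Fin N, (volume.restrict
      (Ioo (((i : ℕ) : ℝ) / N) ((((i : ℕ) : ℝ) + 1) / N))).map fun u => (x i, quantile μ u))
      (empirical x) μ := by
  have hm : ∀ i, Measurable fun u => (x i, quantile μ u) := fun i =>
    measurable_const.prodMk (measurable_quantile μ)
  constructor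
  · rw [Measure.map_finset_sum measurable_fst.aemeasurable, empirical, Finset.smul_sum]
    refine Finset.sum_congr rfl fun i _ => ?_
    rw [Measure.map_map measurable_fst (hm i)]
    change Measure.map (fun _ => x i) _ = _
    rw [Measure.map_const, Measure.restrict_apply_univ, volume_cell]
  · rw [Measure.map_finset_sum measurable_snd.aemeasurable]
    conv_rhs => rw [← map_quantile μ, restrict_Ioo_eq_sum_cells hN,
      Measure.map_finset_sum (measurable_quantile μ).aemeasurable]
    refine Finset.sum_congr rfl fun i _ => ?_
    rw [Measure.map_map measurable_snd (hm i)]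
    rfl

/-- Weak duality: ψ(y) ≤ cost(s, y) + A(s) everywhere, while on the i-th cell ψ equals the cost of
`x i` plus `a i`. Integrating both, the total price of the points cancels. -/
theorem sum_cellCost_le_of_isCoupling {ρ : ℝ} (hρ : 1 ≤ ρ) {N : ℕ} (hN : 1 ≤ N) {x : Fin N → ℝ}
    (hx : Monotone x) {π : Measure (ℝ × ℝ)} (hπ : IsCoupling π (empirical x) μ) :
    ∑ i : Fin N, cellCost μ ρ N i (x i) ≤ ∫⁻ z, ENNReal.ofReal (|z.1 - z.2| ^ ρ) ∂π := by
  obtain ⟨a, ha0, ha⟩ := exists_potential μ hρ x hx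
  let ψ : ℝ → ℝ≥0∞ := fun y => ⨅ i, ENNReal.ofReal (|x i - y| ^ ρ) + ENNReal.ofReal (a i)
  -- The price as a function of position: the infimum deals with coinciding points, and the value ∞
  -- elsewhere is not seen by the empirical measure.
  let A : ℝ → ℝ≥0∞ := fun s => ⨅ i, if s = x i then ENNReal.ofReal (a i) else ∞
  have hψ : Measurable ψ := .iInf fun i => (measurable_cost ρ (x i)).add_const _
  have hA : Measurable A := .iInf fun i =>
    Measurable.ite (measurableSet_singleton (x i)) measurable_const measurable_const
  have hle : ∀ z : ℝ × ℝ, ψ z.2 ≤ ENNReal.ofReal (|z.1 - z.2| ^ ρ) + A z.1 := by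
    intro z
    simp only [A, ENNReal.add_iInf]
    refine le_iInf fun i => ?_
    split_ifs with h
    · rw [h]; exact iInf_le _ i
    · simp
  have hAle : ∀ i, A (x i) ≤ ENNReal.ofReal (a i) := fun i => (iInf_le _ i).trans (by simp)
  have hcost : Measurable fun z : ℝ × ℝ => ENNReal.ofReal (|z.1 - z.2| ^ ρ) := by fun_prop
  have h1 : ∫⁻ y, ψ y ∂μ ≤ ∫⁻ z, ENNReal.ofReal (|z.1 - z.2| ^ ρ) ∂π +
      (N : ℝ≥0∞)⁻¹ * ∑ i, ENNReal.ofReal (a i) := by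
    calc ∫⁻ y, ψ y ∂μ = ∫⁻ z, ψ z.2 ∂π := by
          rw [← lintegral_map hψ measurable_snd, hπ.2]
      _ ≤ ∫⁻ z, (ENNReal.ofReal (|z.1 - z.2| ^ ρ) + A z.1) ∂π := lintegral_mono hle
      _ = ∫⁻ z, ENNReal.ofReal (|z.1 - z.2| ^ ρ) ∂π + ∫⁻ s, A s ∂(empirical x) := by
          rw [lintegral_add_left hcost, ← hπ.1, lintegral_map hA measurable_fst]
      _ ≤ _ := by
          rw [lintegral_empirical x hA]
          gcongr with i
          exact hAle i
  have h2 : ∫⁻ y, ψ y ∂μ = ∑ i : Fin N, cellCost μ ρ N i (x i) +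
      (N : ℝ≥0∞)⁻¹ * ∑ i, ENNReal.ofReal (a i) := by
    rw [lintegral_eq_sum_cells μ hN hψ, Finset.mul_sum, ← Finset.sum_add_distrib]
    refine Finset.sum_congr rfl fun i _ => ?_
    rw [← volume_cell i, mul_comm, ← setLIntegral_const, cellCost,
      ← lintegral_add_right _ measurable_const]
    refine setLIntegral_congr_fun measurableSet_Ioo fun u hu => ?_
    refine le_antisymm (iInf_le _ i) (le_iInf fun k => ?_)
    have h0 : ∀ j, 0 ≤ |x j - quantile μ u| ^ ρ := fun j => Real.rpow_nonneg (abs_nonneg _) _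
    rw [← ENNReal.ofReal_add (h0 _) (ha0 _), ← ENNReal.ofReal_add (h0 _) (ha0 _)]
    exact ENNReal.ofReal_le_ofReal (ha i u hu k)
  rw [h2] at h1
  refine (ENNReal.add_le_add_iff_right ?_).1 h1
  refine ENNReal.mul_ne_top ?_ (ENNReal.sum_ne_top.2 fun i _ => ENNReal.ofReal_ne_top)
  exact ENNReal.inv_ne_top.2 (by exact_mod_cast (by omega : N ≠ 0))

/-- The optimal transport cost from ordered equally weighted points to `μ` is attained by the
quantile coupling. -/
theorem wasserstein_empirical {ρ : ℝ} (hρ : 1 ≤ ρ) {N : ℕ} (hN : 1 ≤ N) {x : Fin N → ℝ}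
    (hx : Monotone x) :
    wasserstein ρ (empirical x) μ = (∑ i : Fin N, cellCost μ ρ N i (x i)) ^ (1 / ρ) := by
  have hcost : Measurable fun z : ℝ × ℝ => ENNReal.ofReal (|z.1 - z.2| ^ ρ) := by fun_prop
  rw [wasserstein]
  congr 1
  refine le_antisymm (iInf₂_le_of_le _ (isCoupling_cells μ hN x) (le_of_eq ?_))
    (le_iInf₂ fun π hπ => sum_cellCost_le_of_isCoupling μ hρ hN hx hπ)
  rw [lintegral_finsetSum_measure]
  refine Finset.sum_congr rfl fun i _ => ?_
  rw [lintegral_map hcost (measurable_const.prodMk (measurable_quantile μ))]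
  rfl

end OptimalTransport

/-! ### Layer-cake formula for the cell cost. -/

section LayerCake

variable (μ : Measure ℝ)

theorem lintegral_Ioi_zero_comp_sub_left (g : ℝ → ℝ≥0∞) (t : ℝ) :
    ∫⁻ s in Ioi 0, g (t - s) = ∫⁻ y in Iio t, g y := by
  rw [← lintegral_indicator measurableSet_Ioi, ← lintegral_indicator measurableSet_Iio]
  refine Eq.trans (lintegral_congr fun s => ?_) (lintegral_sub_left_eq_self _ t)
  simp [indicator]

theorem lintegral_Ioi_zero_comp_add_left (g : ℝ → ℝ≥0∞) (t : ℝ) :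
    ∫⁻ s in Ioi 0, g (t + s) = ∫⁻ y in Ioi t, g y := by
  rw [← lintegral_indicator measurableSet_Ioi, ← lintegral_indicator measurableSet_Ioi]
  refine Eq.trans (lintegral_congr fun s => ?_) (lintegral_add_left_eq_self _ t)
  simp [indicator]

/-- Layer cake is applied separately to the positive and negative parts of t - F⁻¹(u). The version
with ≤ serves the first and the version with < the second, since the level sets then have lengths
given by F. -/
theorem lintegral_cost_quantile {ρ : ℝ} (hρ : 0 < ρ) {a b : ℝ} (ha : 0 ≤ a) (hb : b ≤ 1) (t : ℝ) :
    ∫⁻ u in Ioo a b, ENNReal.ofReal (|t - quantile μ u| ^ ρ) =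
      ENNReal.ofReal ρ *
        ((∫⁻ y in Iio t,
            ENNReal.ofReal ((t - y) ^ (ρ - 1)) * ENNReal.ofReal (min b (cdf μ y) - a)) +
          ∫⁻ y in Ioi t,
            ENNReal.ofReal ((y - t) ^ (ρ - 1)) * ENNReal.ofReal (b - max a (cdf μ y))) := by
  have hq := measurable_quantile μ
  have hsplit : ∀ u, ENNReal.ofReal (|t - quantile μ u| ^ ρ) =
      ENNReal.ofReal (max (t - quantile μ u) 0 ^ ρ) +
        ENNReal.ofReal (max (quantile μ u - t) 0 ^ ρ) := by
    intro u
    rcases le_total (quantile μ u) t with h | h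
    · rw [abs_of_nonneg (by linarith), max_eq_left (by linarith), max_eq_right (by linarith),
        Real.zero_rpow hρ.ne']
      simp
    · rw [abs_of_nonpos (by linarith), max_eq_right (by linarith), max_eq_left (by linarith),
        Real.zero_rpow hρ.ne', neg_sub]
      simp
  have hm : Measurable fun u => max (t - quantile μ u) 0 := by fun_prop
  have hm' : Measurable fun u => max (quantile μ u - t) 0 := by fun_prop
  simp only [hsplit]
  rw [lintegral_add_left (by fun_prop), mul_add,
    lintegral_rpow_eq_lintegral_meas_le_mul _ (f := fun u => max (t - quantile μ u) 0)
      (.of_forall fun u => le_max_right _ _)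
      hm.aemeasurable hρ,
    lintegral_rpow_eq_lintegral_meas_lt_mul _ (f := fun u => max (quantile μ u - t) 0)
      (.of_forall fun u => le_max_right _ _)
      hm'.aemeasurable hρ,
    ← lintegral_Ioi_zero_comp_sub_left (fun y =>
      ENNReal.ofReal ((t - y) ^ (ρ - 1)) * ENNReal.ofReal (min b (cdf μ y) - a)) t,
    ← lintegral_Ioi_zero_comp_add_left (fun y =>
      ENNReal.ofReal ((y - t) ^ (ρ - 1)) * ENNReal.ofReal (b - max a (cdf μ y))) t]
  congr 2
  · refine setLIntegral_congr_fun measurableSet_Ioi fun s (hs : 0 < s) => ?_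
    have : {u | s ≤ max (t - quantile μ u) 0} = {u | quantile μ u ≤ t - s} := by
      ext u
      simp only [mem_ofPred_eq, le_max_iff, not_le.2 hs, or_false, le_sub_comm]
    simp only [this, volume_Ioo_inter_quantile_le μ ha hb, sub_sub_cancel]
    rw [mul_comm]
  · refine setLIntegral_congr_fun measurableSet_Ioi fun s (hs : 0 < s) => ?_
    have : {u | s < max (quantile μ u - t) 0} = {u | t + s < quantile μ u} := by
      ext u
      simp only [mem_ofPred_eq, lt_max_iff, not_lt.2 hs.le, or_false, lt_sub_iff_add_lt']
    simp only [this, volume_Ioo_inter_lt_quantile μ ha hb, add_sub_cancel_left]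
    rw [mul_comm]

end LayerCake

/-! ### From truncated heights to integrals over quantile cells. -/

section CellEnds

variable (μ : Measure ℝ)

theorem le_cdf_of_quantileRight_lt {a y : ℝ} (ha : 0 ≤ a)
    (h : quantileRight μ a < (y : EReal)) : a ≤ cdf μ y := by
  obtain ⟨v, hv, hvy⟩ := by simpa only [quantileRight, iInf_lt_iff] using h
  exact hv.1.le.trans ((quantile_le_iff μ ⟨ha.trans_lt hv.1, hv.2⟩ y).1 (EReal.coe_lt_coe_iff.1 hvy).le)

theorem cdf_le_of_lt_quantileRight {a y : ℝ} (ha : 0 ≤ a) (ha1 : a < 1)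
    (h : (y : EReal) < quantileRight μ a) : cdf μ y ≤ a := by
  refine le_of_not_gt fun hlt => ?_
  obtain ⟨v, hav, hv⟩ := exists_between (lt_min hlt ha1)
  have hv1 : v < 1 := hv.trans_le (min_le_right _ _)
  have h1 := h.trans_le (iInf₂_le v ⟨hav, hv1⟩)
  exact absurd ((quantile_le_iff μ ⟨ha.trans_lt hav, hv1⟩ y).2 (hv.le.trans (min_le_left _ _)))
    (not_le.2 (EReal.coe_lt_coe_iff.1 h1))

theorem cdf_le_of_lt_quantileExt {b y : ℝ} (hb : 0 < b) (hb1 : b ≤ 1)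
    (h : (y : EReal) < quantileExt μ b) : cdf μ y ≤ b := by
  rcases hb1.lt_or_eq with hlt | rfl
  · rw [quantileExt, if_pos hlt, EReal.coe_lt_coe_iff] at h
    exact ((lt_quantile_iff μ ⟨hb, hlt⟩ y).1 h).le
  · exact cdf_le_one μ y

theorem le_cdf_of_quantileExt_lt {b y : ℝ} (hb : 0 < b) (hb1 : b ≤ 1)
    (h : quantileExt μ b < (y : EReal)) : b ≤ cdf μ y := by
  rcases hb1.lt_or_eq with hlt | rfl
  · rw [quantileExt, if_pos hlt, EReal.coe_lt_coe_iff] at h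
    exact (quantile_le_iff μ ⟨hb, hlt⟩ y).1 h.le
  · rw [quantileExt, if_neg (lt_irrefl _)] at h
    refine le_of_forall_lt_imp_le_of_dense fun v hv => ?_
    rcases le_or_gt v 0 with h0 | h0
    · exact h0.trans (cdf_nonneg μ y)
    · exact (quantile_le_iff μ ⟨h0, hv⟩ y).1
        (EReal.coe_lt_coe_iff.1 (lt_of_le_of_lt (le_iSup₂_of_le v ⟨h0, hv⟩ le_rfl) h)).le

theorem quantileRight_le {a u : ℝ} (hu : u ∈ Ioo a 1) :
    quantileRight μ a ≤ (quantile μ u : EReal) := iInf₂_le u hu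

theorem le_quantileExt {b u : ℝ} (hb1 : b ≤ 1) (hu : u ∈ Ioo 0 b) :
    (quantile μ u : EReal) ≤ quantileExt μ b := by
  rcases hb1.lt_or_eq with hlt | rfl
  · rw [quantileExt, if_pos hlt, EReal.coe_le_coe_iff]
    exact monotoneOn_quantile μ ⟨hu.1, hu.2.trans hlt⟩ ⟨hu.1.trans hu.2, hlt⟩ hu.2.le
  · rw [quantileExt, if_neg (lt_irrefl _)]
    exact le_iSup₂_of_le u hu le_rfl

/-- The bounds on F are available for strict comparison with a cell end; this discards the end
itself. -/
theorem ae_coe_ne (c : EReal) : ∀ᵐ y : ℝ, (y : EReal) ≠ c := by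
  filter_upwards [Measure.ae_ne volume c.toReal] with y hy h
  exact hy (by rw [← h, EReal.toReal_coe])

theorem measurableSet_lowerCell (N i : ℕ) (t : ℝ) : MeasurableSet (lowerCell μ N i t) :=
  (measurableSet_le measurable_const measurable_coe_real_ereal).inter measurableSet_Iic

theorem measurableSet_upperCell (N i : ℕ) (t : ℝ) : MeasurableSet (upperCell μ N i t) :=
  measurableSet_Ici.inter (measurableSet_le measurable_coe_real_ereal measurable_const)

variable {N : ℕ} (i : Fin N) {t : ℝ}

theorem ae_nonneg_lowerCell (r : ℝ) : ∀ᵐ y ∂(volume.restrict (lowerCell μ N i t)),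
    0 ≤ (t - y) ^ r * (cdf μ y - ((i : ℕ) : ℝ) / N) := by
  rw [ae_restrict_iff' (measurableSet_lowerCell μ N i t)]
  filter_upwards [ae_coe_ne (quantileRight μ (((i : ℕ) : ℝ) / N))] with y hy hyc
  exact mul_nonneg (Real.rpow_nonneg (sub_nonneg.2 hyc.2) _) (sub_nonneg.2
    (le_cdf_of_quantileRight_lt μ (cell_bounds i).1 (lt_of_le_of_ne hyc.1 hy.symm)))

theorem ae_nonneg_upperCell (r : ℝ) : ∀ᵐ y ∂(volume.restrict (upperCell μ N i t)),
    0 ≤ (y - t) ^ r * ((((i : ℕ) : ℝ) + 1) / N - cdf μ y) := by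
  rw [ae_restrict_iff' (measurableSet_upperCell μ N i t)]
  filter_upwards [ae_coe_ne (quantileExt μ ((((i : ℕ) : ℝ) + 1) / N))] with y hy hyc
  obtain ⟨h0, h1, h2⟩ := cell_bounds i
  exact mul_nonneg (Real.rpow_nonneg (sub_nonneg.2 hyc.1) _) (sub_nonneg.2
    (cdf_le_of_lt_quantileExt μ (h0.trans_lt h1) h2 (lt_of_le_of_ne hyc.2 hy)))

/-- Left of the cell F ≤ i/N, so `ENNReal.ofReal` kills the integrand; left of t the `min` is
inactive because t does not exceed the right end. -/
theorem lintegral_lowerCell (r : ℝ) (ht : (t : EReal) ≤ quantileExt μ ((((i : ℕ) : ℝ) + 1) / N)) :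
    ∫⁻ y in Iio t, ENNReal.ofReal ((t - y) ^ r) *
        ENNReal.ofReal (min ((((i : ℕ) : ℝ) + 1) / N) (cdf μ y) - ((i : ℕ) : ℝ) / N) =
      ∫⁻ y in lowerCell μ N i t,
        ENNReal.ofReal ((t - y) ^ r * (cdf μ y - ((i : ℕ) : ℝ) / N)) := by
  obtain ⟨h0, h1, h2⟩ := cell_bounds i
  rw [← lintegral_indicator measurableSet_Iio,
    ← lintegral_indicator (measurableSet_lowerCell μ N i t)]
  refine lintegral_congr_ae ?_
  filter_upwards [Measure.ae_ne volume t, ae_coe_ne (quantileRight μ (((i : ℕ) : ℝ) / N))]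
    with y hyt hyα
  rcases lt_or_gt_of_ne hyt with hlt | hgt
  · rw [indicator_of_mem (mem_Iio.2 hlt)]
    have hyb := cdf_le_of_lt_quantileExt μ (h0.trans_lt h1) h2
      ((EReal.coe_lt_coe_iff.2 hlt).trans_le ht)
    rw [min_eq_right hyb]
    rcases lt_or_gt_of_ne hyα with hα | hα
    · rw [indicator_of_notMem fun h => absurd h.1 (not_le.2 hα), ENNReal.ofReal_of_nonpos
        (sub_nonpos.2 (cdf_le_of_lt_quantileRight μ h0 (h1.trans_le h2) hα)), mul_zero]
    · rw [indicator_of_mem (show y ∈ lowerCell μ N i t from ⟨hα.le, hlt.le⟩),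
        ENNReal.ofReal_mul (Real.rpow_nonneg (sub_nonneg.2 hlt.le) _)]
  · rw [indicator_of_notMem (notMem_Iio.2 hgt.le),
      indicator_of_notMem fun h => absurd h.2 (not_le.2 hgt)]

theorem lintegral_upperCell (r : ℝ) (ht : quantileRight μ (((i : ℕ) : ℝ) / N) ≤ (t : EReal)) :
    ∫⁻ y in Ioi t, ENNReal.ofReal ((y - t) ^ r) *
        ENNReal.ofReal ((((i : ℕ) : ℝ) + 1) / N - max (((i : ℕ) : ℝ) / N) (cdf μ y)) =
      ∫⁻ y in upperCell μ N i t,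
        ENNReal.ofReal ((y - t) ^ r * ((((i : ℕ) : ℝ) + 1) / N - cdf μ y)) := by
  obtain ⟨h0, h1, h2⟩ := cell_bounds i
  rw [← lintegral_indicator measurableSet_Ioi,
    ← lintegral_indicator (measurableSet_upperCell μ N i t)]
  refine lintegral_congr_ae ?_
  filter_upwards [Measure.ae_ne volume t, ae_coe_ne (quantileExt μ ((((i : ℕ) : ℝ) + 1) / N))]
    with y hyt hyβ
  rcases lt_or_gt_of_ne hyt with hlt | hgt
  · rw [indicator_of_notMem (notMem_Ioi.2 hlt.le),
      indicator_of_notMem fun h => absurd h.1 (not_le.2 hlt)]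
  · rw [indicator_of_mem (mem_Ioi.2 hgt)]
    have hya := le_cdf_of_quantileRight_lt μ h0 (ht.trans_lt (EReal.coe_lt_coe_iff.2 hgt))
    rw [max_eq_right hya]
    rcases lt_or_gt_of_ne hyβ with hβ | hβ
    · rw [indicator_of_mem (show y ∈ upperCell μ N i t from ⟨hgt.le, hβ.le⟩),
        ENNReal.ofReal_mul (Real.rpow_nonneg (sub_nonneg.2 hgt.le) _)]
    · rw [indicator_of_notMem fun h => absurd h.2 (not_le.2 hβ), ENNReal.ofReal_of_nonpos
        (sub_nonpos.2 (le_cdf_of_quantileExt_lt μ (h0.trans_lt h1) h2 hβ)), mul_zero]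

theorem measurable_cdf : Measurable (cdf μ) := (monotone_cdf μ).measurable

theorem cellCost_formula {ρ : ℝ} (hρ : 1 ≤ ρ) (hfin : cellCost μ ρ N i t ≠ ∞)
    (hα : quantileRight μ (((i : ℕ) : ℝ) / N) ≤ (t : EReal))
    (hβ : (t : EReal) ≤ quantileExt μ ((((i : ℕ) : ℝ) + 1) / N)) :
    IntegrableOn (fun y : ℝ => (t - y) ^ (ρ - 1) * (cdf μ y - ((i : ℕ) : ℝ) / N))
        (lowerCell μ N i t) ∧
      IntegrableOn (fun y : ℝ => (y - t) ^ (ρ - 1) * ((((i : ℕ) : ℝ) + 1) / N - cdf μ y))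
        (upperCell μ N i t) ∧
      (cellCost μ ρ N i t).toReal =
        ρ * ((∫ y in lowerCell μ N i t, (t - y) ^ (ρ - 1) * (cdf μ y - ((i : ℕ) : ℝ) / N)) +
          ∫ y in upperCell μ N i t,
            (y - t) ^ (ρ - 1) * ((((i : ℕ) : ℝ) + 1) / N - cdf μ y)) := by
  have hρ0 : 0 < ρ := by linarith
  obtain ⟨h0, h1, h2⟩ := cell_bounds i
  have hF := measurable_cdf μ
  have hl : Measurable fun y : ℝ => (t - y) ^ (ρ - 1) * (cdf μ y - ((i : ℕ) : ℝ) / N) := by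
    fun_prop
  have hu : Measurable fun y : ℝ => (y - t) ^ (ρ - 1) * ((((i : ℕ) : ℝ) + 1) / N - cdf μ y) := by
    fun_prop
  have heq : cellCost μ ρ N i t = _ := lintegral_cost_quantile μ hρ0 h0 h2 t
  rw [lintegral_lowerCell μ i _ hβ, lintegral_upperCell μ i _ hα] at heq
  -- Both terms are nonnegative, so a finite cost forces both integrals to converge.
  have hsum := ENNReal.add_ne_top.1 fun h => hfin
    (by rw [heq, h, ENNReal.mul_top (ENNReal.ofReal_pos.2 hρ0).ne'])
  have hil := (lintegral_ofReal_ne_top_iff_integrable hl.aestronglyMeasurable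
    (ae_nonneg_lowerCell μ i (ρ - 1))).1 hsum.1
  have hiu := (lintegral_ofReal_ne_top_iff_integrable hu.aestronglyMeasurable
    (ae_nonneg_upperCell μ i (ρ - 1))).1 hsum.2
  refine ⟨hil, hiu, ?_⟩
  rw [heq, ENNReal.toReal_mul, ENNReal.toReal_add hsum.1 hsum.2, ENNReal.toReal_ofReal hρ0.le,
    integral_eq_lintegral_of_nonneg_ae (ae_nonneg_lowerCell μ i (ρ - 1)) hl.aestronglyMeasurable,
    integral_eq_lintegral_of_nonneg_ae (ae_nonneg_upperCell μ i (ρ - 1)) hu.aestronglyMeasurable]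

end CellEnds

/-! ### Existence, location and ordering of minimizers. -/

section Minimizers

open Filter Topology

variable (μ : Measure ℝ) {ρ : ℝ}

theorem cellCost_eq_eLpNorm (hρ : 1 ≤ ρ) {N : ℕ} (i : Fin N) (y : ℝ) :
    cellCost μ ρ N i y = eLpNorm (fun u => y - quantile μ u) (ENNReal.ofReal ρ)
      (volume.restrict (Ioo (((i : ℕ) : ℝ) / N) ((((i : ℕ) : ℝ) + 1) / N))) ^ ρ := by
  have hρ0 : 0 < ρ := by linarith
  rw [eLpNorm_eq_lintegral_rpow_enorm_toReal (ENNReal.ofReal_pos.2 hρ0).ne' ENNReal.ofReal_ne_top,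
    ENNReal.toReal_ofReal hρ0.le, ← ENNReal.rpow_mul, one_div_mul_cancel hρ0.ne',
    ENNReal.rpow_one, cellCost]
  refine lintegral_congr fun u => ?_
  rw [Real.enorm_eq_ofReal_abs, ENNReal.ofReal_rpow_of_nonneg (abs_nonneg _) hρ0.le]

variable [IsProbabilityMeasure μ]

theorem memLp_quantile (hρ : 1 ≤ ρ) (hμ : Integrable (fun x : ℝ => |x| ^ ρ) μ) :
    MemLp (quantile μ) (ENNReal.ofReal ρ) (volume.restrict (Ioo (0 : ℝ) 1)) := by
  have hρ0 : 0 < ρ := by linarith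
  rw [← integrable_norm_rpow_iff (measurable_quantile μ).aestronglyMeasurable
    (ENNReal.ofReal_pos.2 hρ0).ne' ENNReal.ofReal_ne_top, ENNReal.toReal_ofReal hρ0.le]
  rw [← map_quantile μ] at hμ
  exact hμ.comp_measurable (measurable_quantile μ)

theorem memLp_sub_quantile (hρ : 1 ≤ ρ) (hμ : Integrable (fun x : ℝ => |x| ^ ρ) μ) {N : ℕ}
    (i : Fin N) (y : ℝ) :
    MemLp (fun u => y - quantile μ u) (ENNReal.ofReal ρ)
      (volume.restrict (Ioo (((i : ℕ) : ℝ) / N) ((((i : ℕ) : ℝ) + 1) / N))) :=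
  (memLp_const y).sub ((memLp_quantile μ hρ hμ).mono_measure
    (Measure.restrict_mono (cell_subset i) le_rfl))

theorem cellCost_ne_top (hρ : 1 ≤ ρ) (hμ : Integrable (fun x : ℝ => |x| ^ ρ) μ) {N : ℕ}
    (i : Fin N) (y : ℝ) : cellCost μ ρ N i y ≠ ∞ := by
  rw [cellCost_eq_eLpNorm μ hρ]
  exact ENNReal.rpow_ne_top_of_nonneg (by linarith) (memLp_sub_quantile μ hρ hμ i y).2.ne

/-- The cost is the ρ-th power of the distance in `Lp` from the constant y to the quantile function.
This distance is continuous in y, and coercive because the cell has positive mass. -/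
theorem exists_cellCost_minimizer (hρ : 1 ≤ ρ) (hμ : Integrable (fun x : ℝ => |x| ^ ρ) μ) {N : ℕ}
    (i : Fin N) : ∃ x, ∀ y, cellCost μ ρ N i x ≤ cellCost μ ρ N i y := by
  have hρ0 : 0 < ρ := by linarith
  have : Fact (1 ≤ ENNReal.ofReal ρ) := ⟨ENNReal.one_le_ofReal.2 hρ⟩
  set ν := volume.restrict (Ioo (((i : ℕ) : ℝ) / N) ((((i : ℕ) : ℝ) + 1) / N)) with hν
  have hQ : MemLp (quantile μ) (ENNReal.ofReal ρ) ν := (memLp_quantile μ hρ hμ).mono_measure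
    (Measure.restrict_mono (cell_subset i) le_rfl)
  let f : ℝ → ℝ := fun y => ‖Lp.constL (ENNReal.ofReal ρ) ν ℝ y - hQ.toLp‖
  have hf : Continuous f := by fun_prop
  have hc : 0 < ν.real univ ^ (1 / (ENNReal.ofReal ρ).toReal) := by
    refine Real.rpow_pos_of_pos ?_ _
    rw [measureReal_def, hν, Measure.restrict_apply_univ, volume_cell]
    have : 0 < N := i.pos
    simp [this]
  have hlim : Tendsto f (cocompact ℝ) atTop := by
    have h1 : Tendsto (fun y : ℝ => ‖y‖ * ν.real univ ^ (1 / (ENNReal.ofReal ρ).toReal) -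
        ‖hQ.toLp‖) (cocompact ℝ) atTop :=
      tendsto_atTop_add_const_right _ _ ((tendsto_norm_cocompact_atTop).atTop_mul_const hc)
    refine tendsto_atTop_mono (fun y => ?_) h1
    rw [← Lp.norm_const' _ _ y (ENNReal.ofReal_pos.2 hρ0).ne' ENNReal.ofReal_ne_top]
    exact norm_sub_norm_le _ _
  obtain ⟨x, hx⟩ := hf.exists_forall_le hlim
  refine ⟨x, fun y => ?_⟩
  have hcost : ∀ y, cellCost μ ρ N i y = ENNReal.ofReal (f y) ^ ρ := by
    intro y
    rw [cellCost_eq_eLpNorm μ hρ, ← Lp.enorm_toLp (memLp_sub_quantile μ hρ hμ i y), ofReal_norm]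
    rfl
  rw [hcost, hcost]
  exact ENNReal.rpow_le_rpow (ENNReal.ofReal_le_ofReal (hx y)) hρ0.le

/-- From a point outside the cell, moving to the nearest end strictly decreases the distance to
every quantile value of the cell. -/
theorem mem_cell_of_isMin (hρ : 1 ≤ ρ) (hμ : Integrable (fun x : ℝ => |x| ^ ρ) μ) {N : ℕ}
    (i : Fin N) {x : ℝ} (hx : ∀ y, cellCost μ ρ N i x ≤ cellCost μ ρ N i y) :
    quantileRight μ (((i : ℕ) : ℝ) / N) ≤ (x : EReal) ∧
      (x : EReal) ≤ quantileExt μ ((((i : ℕ) : ℝ) + 1) / N) := by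
  have hρ0 : 0 < ρ := by linarith
  obtain ⟨h0, h1, h2⟩ := cell_bounds i
  have hstrict : ∀ z, (∀ u ∈ Ioo (((i : ℕ) : ℝ) / N) ((((i : ℕ) : ℝ) + 1) / N),
      |z - quantile μ u| < |x - quantile μ u|) → False := by
    intro z hz
    refine absurd (hx z) (not_le.2 (setLIntegral_strict_mono measurableSet_Ioo ?_ ?_
      (cellCost_ne_top μ hρ hμ i z) (.of_forall fun u hu => ?_)))
    · rw [volume_cell]; simp
    · have := measurable_quantile μ; fun_prop
    · exact (ENNReal.ofReal_lt_ofReal_iff_of_nonneg (Real.rpow_nonneg (abs_nonneg _) _)).2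
        (Real.rpow_lt_rpow (abs_nonneg _) (hz u hu) hρ0)
  -- The violated bound excludes one infinite value of the cell end, and the finite quantile at m
  -- excludes the other.
  obtain ⟨m, hm⟩ := exists_between h1
  constructor
  · by_contra! hlt
    have hle : quantileRight μ (((i : ℕ) : ℝ) / N) ≤ (quantile μ m : EReal) :=
      quantileRight_le μ ⟨hm.1, hm.2.trans_le h2⟩
    lift quantileRight μ (((i : ℕ) : ℝ) / N) to ℝ using
      ⟨(hle.trans_lt (EReal.coe_lt_top _)).ne, ((EReal.bot_lt_coe x).trans hlt).ne'⟩ with z hz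
    refine hstrict z fun u hu => ?_
    have hxz : x < z := EReal.coe_lt_coe_iff.1 hlt
    have hzu : z ≤ quantile μ u := EReal.coe_le_coe_iff.1
      (hz.le.trans (quantileRight_le μ ⟨hu.1, hu.2.trans_le h2⟩))
    rw [abs_of_nonpos (by linarith), abs_of_nonpos (by linarith)]
    linarith
  · by_contra! hlt
    have hle : (quantile μ m : EReal) ≤ quantileExt μ ((((i : ℕ) : ℝ) + 1) / N) :=
      le_quantileExt μ h2 ⟨h0.trans_lt hm.1, hm.2⟩
    lift quantileExt μ ((((i : ℕ) : ℝ) + 1) / N) to ℝ using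
      ⟨(hlt.trans (EReal.coe_lt_top x)).ne, ((EReal.bot_lt_coe _).trans_le hle).ne'⟩ with z hz
    refine hstrict z fun u hu => ?_
    have hxz : z < x := EReal.coe_lt_coe_iff.1 hlt
    have hzu : quantile μ u ≤ z := EReal.coe_le_coe_iff.1
      ((le_quantileExt μ h2 ⟨h0.trans_lt hu.1, hu.2⟩).trans hz.ge)
    rw [abs_of_nonneg (by linarith), abs_of_nonneg (by linarith)]
    linarith

/-- Distinct cells are ordered: F⁻¹((i+1)/N) ≤ F⁻¹((j/N)+) for i < j. Hence optimal points compete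
in `minError`. -/
theorem IsOptimal.monotone (hρ : 1 ≤ ρ) (hμ : Integrable (fun x : ℝ => |x| ^ ρ) μ) {N : ℕ}
    {x : Fin N → ℝ} (hx : IsOptimal μ ρ x) : Monotone x := by
  refine monotone_iff_forall_lt.2 fun i j hij => ?_
  have hN0 : (0 : ℝ) < N := by exact_mod_cast i.pos
  obtain ⟨h0, h1, h2⟩ := cell_bounds i
  have hij' : ((i : ℕ) : ℝ) + 1 ≤ ((j : ℕ) : ℝ) := by exact_mod_cast Nat.succ_le_of_lt hij
  have hjN : ((j : ℕ) : ℝ) < N := by exact_mod_cast j.2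
  have hlt : (((i : ℕ) : ℝ) + 1) / N < 1 := (div_lt_one hN0).2 (by linarith)
  refine EReal.coe_le_coe_iff.1 ((mem_cell_of_isMin μ hρ hμ i (hx i)).2.trans
    (le_trans ?_ (mem_cell_of_isMin μ hρ hμ j (hx j)).1))
  rw [quantileExt, if_pos hlt]
  refine le_iInf₂ fun v hv => EReal.coe_le_coe_iff.2 (monotoneOn_quantile μ
    ⟨h0.trans_lt h1, hlt⟩ ⟨(cell_bounds j).1.trans_lt hv.1, hv.2⟩ (le_trans ?_ hv.1.le))
  gcongr

theorem minError_eq (hρ : 1 ≤ ρ) (hμ : Integrable (fun x : ℝ => |x| ^ ρ) μ) {N : ℕ} (hN : 1 ≤ N)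
    {x : Fin N → ℝ} (hx : IsOptimal μ ρ x) :
    minError N μ ρ = (∑ i : Fin N, cellCost μ ρ N i (x i)) ^ (1 / ρ) := by
  refine le_antisymm ?_ (le_iInf₂ fun y hy => ?_)
  · have hm := IsOptimal.monotone μ hρ hμ hx
    exact (iInf₂_le x hm).trans_eq (wasserstein_empirical μ hρ hN hm)
  · rw [wasserstein_empirical μ hρ hN hy]
    exact ENNReal.rpow_le_rpow (Finset.sum_le_sum fun i _ => hx i (y i))
      (one_div_nonneg.2 (by linarith))

theorem toReal_minError_rpow (hρ : 1 ≤ ρ) (hμ : Integrable (fun x : ℝ => |x| ^ ρ) μ) {N : ℕ}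
    (hN : 1 ≤ N) {x : Fin N → ℝ} (hx : IsOptimal μ ρ x) :
    (minError N μ ρ).toReal ^ ρ = ∑ i : Fin N, (cellCost μ ρ N i (x i)).toReal := by
  have hρ0 : 0 < ρ := by linarith
  rw [minError_eq μ hρ hμ hN hx, ENNReal.toReal_rpow, ← ENNReal.rpow_mul,
    one_div_mul_cancel hρ0.ne', ENNReal.rpow_one,
    ENNReal.toReal_sum fun i _ => cellCost_ne_top μ hρ hμ i (x i)]

end Minimizers

/-! ### The case ρ = 1: medians and tent functions. -/

section Medians

theorem setLIntegral_Ioo_eq_pairing {g : ℝ → ℝ≥0∞} (hg : Measurable g) (a : ℝ) {h : ℝ}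
    (hh : 0 ≤ h) :
    ∫⁻ u in Ioo a (a + 2 * h), g u = ∫⁻ u in Ioo a (a + h), (g u + g (u + h)) := by
  have hshift : ∫⁻ u in Ioc (a + h) (a + 2 * h), g u = ∫⁻ u in Ioc a (a + h), g (u + h) := by
    rw [← lintegral_indicator measurableSet_Ioc, ← lintegral_indicator measurableSet_Ioc,
      ← lintegral_add_right_eq_self _ h]
    refine lintegral_congr fun u => ?_
    have : u + h ∈ Ioc (a + h) (a + 2 * h) ↔ u ∈ Ioc a (a + h) := by
      constructor <;> rintro ⟨h1, h2⟩ <;> constructor <;> linarith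
    by_cases hu : u ∈ Ioc a (a + h)
    · rw [indicator_of_mem hu, indicator_of_mem (this.2 hu)]
    · rw [indicator_of_notMem hu, indicator_of_notMem (this.not.2 hu)]
  rw [Measure.restrict_congr_set Ioo_ae_eq_Ioc, Measure.restrict_congr_set Ioo_ae_eq_Ioc,
    ← Ioc_union_Ioc_eq_Ioc (show a ≤ a + h by linarith) (show a + h ≤ a + 2 * h by linarith),
    lintegral_union measurableSet_Ioc (Ioc_disjoint_Ioc_of_le le_rfl), hshift,
    lintegral_add_left hg]

variable (μ : Measure ℝ)

theorem medianLevel_mem {N : ℕ} (i : Fin N) :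
    (2 * ((i : ℕ) : ℝ) + 1) / (2 * N) ∈
      Ioo (((i : ℕ) : ℝ) / N) ((((i : ℕ) : ℝ) + 1) / N) := by
  have hN0 : (0 : ℝ) < N := by exact_mod_cast i.pos
  constructor
  · rw [div_lt_div_iff₀ hN0 (by linarith)]; nlinarith
  · rw [div_lt_div_iff₀ (by linarith) hN0]; nlinarith

/-- Pair each level u in the lower half of the cell with u + h, h being half its length. The median
lies between the two quantiles, so it minimizes the sum of the distances to them. -/
theorem isOptimal_medianPoints (N : ℕ) : IsOptimal μ 1 (medianPoints μ N) := by
  intro i y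
  have hN0 : (0 : ℝ) < N := by exact_mod_cast i.pos
  have hq := measurable_quantile μ
  set a := ((i : ℕ) : ℝ) / N with ha
  set h : ℝ := 1 / (2 * N) with hh
  have hh0 : 0 < h := by positivity
  have hb : (((i : ℕ) : ℝ) + 1) / N = a + 2 * h := by rw [ha, hh]; field_simp
  have hm : (2 * ((i : ℕ) : ℝ) + 1) / (2 * N) = a + h := by rw [ha, hh]; field_simp
  have hsub : Ioo a (a + 2 * h) ⊆ Ioo 0 1 := by rw [← hb]; exact cell_subset i
  rw [cellCost, cellCost, ← ha, hb, setLIntegral_Ioo_eq_pairing (by fun_prop) a hh0.le,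
    setLIntegral_Ioo_eq_pairing (by fun_prop) a hh0.le]
  refine setLIntegral_mono' measurableSet_Ioo fun u hu => ?_
  have hu1 : u ∈ Ioo (0 : ℝ) 1 := hsub ⟨hu.1, by linarith [hu.2]⟩
  have hu2 : u + h ∈ Ioo (0 : ℝ) 1 := hsub ⟨by linarith [hu.1], by linarith [hu.2]⟩
  have hu3 : a + h ∈ Ioo (0 : ℝ) 1 := hsub ⟨by linarith, by linarith⟩
  have h1 := monotoneOn_quantile μ hu1 hu3 hu.2.le
  have h2 := monotoneOn_quantile μ hu3 hu2 (by linarith [hu.1])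
  simp only [Real.rpow_one, medianPoints, hm]
  rw [← ENNReal.ofReal_add (abs_nonneg _) (abs_nonneg _),
    ← ENNReal.ofReal_add (abs_nonneg _) (abs_nonneg _)]
  refine ENNReal.ofReal_le_ofReal ?_
  rw [abs_of_nonneg (sub_nonneg.2 h1), abs_of_nonpos (sub_nonpos.2 h2)]
  linarith [le_abs_self (y - quantile μ u), neg_abs_le (y - quantile μ (u + h))]

/-- The median separates F below the mid-level from F above it, which decides the `min`. Where F
leaves the cell of levels the `min` is negative and `ENNReal.ofReal` gives 0. -/
theorem cellCost_medianPoints {N : ℕ} (i : Fin N) :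
    cellCost μ 1 N i (medianPoints μ N i) =
      ∫⁻ y, ENNReal.ofReal (min (cdf μ y - ((i : ℕ) : ℝ) / N)
        ((((i : ℕ) : ℝ) + 1) / N - cdf μ y)) := by
  have hN0 : (0 : ℝ) < N := by exact_mod_cast i.pos
  obtain ⟨h0, h1, h2⟩ := cell_bounds i
  have hmem := medianLevel_mem i
  have hmid : 2 * ((2 * ((i : ℕ) : ℝ) + 1) / (2 * N)) =
      ((i : ℕ) : ℝ) / N + (((i : ℕ) : ℝ) + 1) / N := by field_simp; ring
  have h01 := cell_subset i hmem
  refine (lintegral_cost_quantile μ one_pos h0 h2 _).trans ?_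
  rw [← lintegral_indicator measurableSet_Iio, ← lintegral_indicator measurableSet_Ioi,
    ENNReal.ofReal_one, one_mul, ← lintegral_add_left]
  · refine lintegral_congr_ae ?_
    filter_upwards [Measure.ae_ne volume (medianPoints μ N i)] with y hy
    rcases lt_or_gt_of_ne hy with hlt | hgt
    · have hF := (lt_quantile_iff μ h01 y).1 hlt
      rw [indicator_of_mem (mem_Iio.2 hlt), indicator_of_notMem (notMem_Ioi.2 hlt.le), sub_self,
        Real.rpow_zero, ENNReal.ofReal_one, one_mul, add_zero, min_eq_right (by linarith [hmem.2]),
        min_eq_left (by linarith)]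
    · have hF := (quantile_le_iff μ h01 y).1 hgt.le
      rw [indicator_of_notMem (notMem_Iio.2 hgt.le), indicator_of_mem (mem_Ioi.2 hgt), sub_self,
        Real.rpow_zero, ENNReal.ofReal_one, one_mul, zero_add, max_eq_right (by linarith [hmem.1]),
        min_eq_right (by linarith)]
  · have := measurable_cdf μ
    exact Measurable.indicator (by fun_prop) measurableSet_Iio

theorem iInf_abs_sub_natCast {w : ℝ} (hw : 0 ≤ w) :
    ⨅ j : ℕ, |w - j| = min (w - ⌊w⌋₊) (⌊w⌋₊ + 1 - w) := by
  have h1 := Nat.floor_le hw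
  have h2 := Nat.lt_floor_add_one w
  have hbdd : BddBelow (range fun j : ℕ => |w - j|) := ⟨0, by rintro _ ⟨j, rfl⟩; exact abs_nonneg _⟩
  refine le_antisymm (le_min ?_ ?_) (le_ciInf fun j => ?_)
  · exact (ciInf_le hbdd ⌊w⌋₊).trans_eq (abs_of_nonneg (by linarith))
  · refine (ciInf_le hbdd (⌊w⌋₊ + 1)).trans_eq ?_
    rw [abs_of_nonpos (by push_cast; linarith)]
    push_cast; ring
  · rcases le_or_gt j ⌊w⌋₊ with hj | hj
    · have : (j : ℝ) ≤ ⌊w⌋₊ := by exact_mod_cast hj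
      exact (min_le_left _ _).trans (le_trans (by linarith) (le_abs_self _))
    · have : (⌊w⌋₊ : ℝ) + 1 ≤ j := by exact_mod_cast hj
      exact (min_le_right _ _).trans (le_trans (by linarith) (neg_le_abs _))

/-- The tents have disjoint supports: only the index ⌊Nv⌋ can contribute. -/
theorem sum_tent_eq {N : ℕ} {v : ℝ} (hv0 : 0 ≤ v) (hv1 : v ≤ 1) :
    ∑ i : Fin N, ENNReal.ofReal (min (v - ((i : ℕ) : ℝ) / N) ((((i : ℕ) : ℝ) + 1) / N - v)) =
      ENNReal.ofReal (1 / (N : ℝ) * ⨅ j : ℕ, |(N : ℝ) * v - j|) := by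
  rcases Nat.eq_zero_or_pos N with rfl | hN
  · simp
  have hN0 : (0 : ℝ) < N := by exact_mod_cast hN
  have hw0 : 0 ≤ (N : ℝ) * v := by positivity
  have hwN : (N : ℝ) * v ≤ N := by nlinarith
  have hterm : ∀ i : ℕ, min (v - (i : ℝ) / N) (((i : ℝ) + 1) / N - v) =
      1 / N * min ((N : ℝ) * v - i) (i + 1 - (N : ℝ) * v) := by
    intro i
    rw [mul_min_of_nonneg _ _ (show (0 : ℝ) ≤ 1 / N by positivity)]
    congr 1 <;> field_simp
  rw [iInf_abs_sub_natCast hw0]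
  simp only [hterm]
  set w := (N : ℝ) * v
  have h1 := Nat.floor_le hw0
  have h2 := Nat.lt_floor_add_one w
  have hzero : ∀ i : ℕ, i ≠ ⌊w⌋₊ →
      ENNReal.ofReal (1 / (N : ℝ) * min (w - i) (i + 1 - w)) = 0 := by
    intro i hi
    refine ENNReal.ofReal_of_nonpos (mul_nonpos_of_nonneg_of_nonpos (by positivity) ?_)
    rcases lt_or_gt_of_ne hi with h | h
    · have : (i : ℝ) + 1 ≤ ⌊w⌋₊ := by exact_mod_cast h
      exact (min_le_right _ _).trans (by linarith)
    · have : (⌊w⌋₊ : ℝ) + 1 ≤ i := by exact_mod_cast h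
      exact (min_le_left _ _).trans (by linarith)
  rcases lt_or_ge ⌊w⌋₊ N with hk | hk
  · rw [Finset.sum_eq_single_of_mem (⟨⌊w⌋₊, hk⟩ : Fin N) (Finset.mem_univ _)
      fun i _ hi => hzero i fun h => hi (Fin.ext h)]
  -- Here v = 1: no cell has index N, and both sides vanish.
  · have hk' : (N : ℝ) ≤ ⌊w⌋₊ := by exact_mod_cast hk
    rw [Finset.sum_eq_zero fun (i : Fin N) _ => hzero i (by omega), eq_comm]
    refine ENNReal.ofReal_of_nonpos (mul_nonpos_of_nonneg_of_nonpos (by positivity) ?_)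
    exact (min_le_left _ _).trans (by linarith)

theorem measurable_iInf_abs_sub_natCast (N : ℕ) :
    Measurable fun y : ℝ => ⨅ j : ℕ, |(N : ℝ) * cdf μ y - j| := by
  have := measurable_cdf μ
  have h0 : ∀ y, 0 ≤ (N : ℝ) * cdf μ y := fun y => mul_nonneg (Nat.cast_nonneg _) (cdf_nonneg μ y)
  simp only [fun y => iInf_abs_sub_natCast (h0 y)]
  fun_prop

theorem sum_cellCost_medianPoints (N : ℕ) :
    ∑ i : Fin N, cellCost μ 1 N i (medianPoints μ N i) =
      ∫⁻ y, ENNReal.ofReal (1 / (N : ℝ) * ⨅ j : ℕ, |(N : ℝ) * cdf μ y - j|) := by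
  have := measurable_cdf μ
  simp only [cellCost_medianPoints]
  rw [← lintegral_finsetSum _ fun i _ => by fun_prop]
  exact lintegral_congr fun y => sum_tent_eq (cdf_nonneg μ y) (cdf_le_one μ y)

end Medians

/-! ### The main theorem. -/

theorem proposition1 (μ : Measure ℝ) [IsProbabilityMeasure μ] (ρ : ℝ) (hρ : 1 ≤ ρ)
    (hμ : Integrable (fun x : ℝ => |x| ^ ρ) μ) (N : ℕ) (hN : 1 ≤ N) :
    minError N μ ρ ≠ ∞ ∧
    (∃ x : Fin N → ℝ, IsOptimal μ ρ x) ∧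
    (∀ x : Fin N → ℝ, IsOptimal μ ρ x →
      (∀ i : Fin N,
        quantileRight μ (((i : ℕ) : ℝ) / N) ≤ (x i : EReal) ∧
        (x i : EReal) ≤ quantileExt μ ((((i : ℕ) : ℝ) + 1) / N) ∧
        IntegrableOn (fun y : ℝ => (x i - y) ^ (ρ - 1) * (cdf μ y - ((i : ℕ) : ℝ) / N))
          (lowerCell μ N i (x i)) ∧
        IntegrableOn (fun y : ℝ => (y - x i) ^ (ρ - 1) * ((((i : ℕ) : ℝ) + 1) / N - cdf μ y))
          (upperCell μ N i (x i))) ∧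
      (minError N μ ρ).toReal ^ ρ = ρ * ∑ i : Fin N,
        ((∫ y in lowerCell μ N i (x i),
            (x i - y) ^ (ρ - 1) * (cdf μ y - ((i : ℕ) : ℝ) / N)) +
          ∫ y in upperCell μ N i (x i),
            (y - x i) ^ (ρ - 1) * ((((i : ℕ) : ℝ) + 1) / N - cdf μ y))) ∧
    (ρ = 1 →
      IsOptimal μ 1 (medianPoints μ N) ∧
      (minError N μ 1).toReal = ∑ i : Fin N,
        ((∫ y in lowerCell μ N i (medianPoints μ N i), (cdf μ y - ((i : ℕ) : ℝ) / N)) +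
          ∫ y in upperCell μ N i (medianPoints μ N i),
            ((((i : ℕ) : ℝ) + 1) / N - cdf μ y)) ∧
      Integrable (fun y : ℝ => ⨅ j : ℕ, |(N : ℝ) * cdf μ y - j|) ∧
      (minError N μ 1).toReal =
        1 / (N : ℝ) * ∫ y : ℝ, ⨅ j : ℕ, |(N : ℝ) * cdf μ y - j|) := by
  have hρ0 : 0 < ρ := by linarith
  have hN0 : (0 : ℝ) < N := by exact_mod_cast hN
  obtain ⟨x₀, hx₀⟩ : ∃ x : Fin N → ℝ, IsOptimal μ ρ x := by
    choose x hx using fun i : Fin N => exists_cellCost_minimizer μ hρ hμ i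
    exact ⟨x, hx⟩
  have hform : ∀ x : Fin N → ℝ, IsOptimal μ ρ x →
      (minError N μ ρ).toReal ^ ρ = ρ * ∑ i : Fin N,
        ((∫ y in lowerCell μ N i (x i),
            (x i - y) ^ (ρ - 1) * (cdf μ y - ((i : ℕ) : ℝ) / N)) +
          ∫ y in upperCell μ N i (x i),
            (y - x i) ^ (ρ - 1) * ((((i : ℕ) : ℝ) + 1) / N - cdf μ y)) := by
    intro x hx
    rw [toReal_minError_rpow μ hρ hμ hN hx, Finset.mul_sum]
    refine Finset.sum_congr rfl fun i _ => ?_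
    obtain ⟨hα, hβ⟩ := mem_cell_of_isMin μ hρ hμ i (hx i)
    exact (cellCost_formula μ i hρ (cellCost_ne_top μ hρ hμ i _) hα hβ).2.2
  refine ⟨?_, ⟨x₀, hx₀⟩, fun x hx => ⟨fun i => ?_, hform x hx⟩, ?_⟩
  · rw [minError_eq μ hρ hμ hN hx₀]
    exact ENNReal.rpow_ne_top_of_nonneg (one_div_nonneg.2 hρ0.le)
      (ENNReal.sum_ne_top.2 fun i _ => cellCost_ne_top μ hρ hμ i _)
  · obtain ⟨hα, hβ⟩ := mem_cell_of_isMin μ hρ hμ i (hx i)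
    obtain ⟨h1, h2, -⟩ := cellCost_formula μ i hρ (cellCost_ne_top μ hρ hμ i _) hα hβ
    exact ⟨hα, hβ, h1, h2⟩
  · rintro rfl
    have hopt := isOptimal_medianPoints μ N
    have hnonneg : ∀ y, 0 ≤ 1 / (N : ℝ) * ⨅ j : ℕ, |(N : ℝ) * cdf μ y - j| := fun y =>
      mul_nonneg (by positivity) (Real.iInf_nonneg fun j => abs_nonneg _)
    have hmeas := ((measurable_iInf_abs_sub_natCast μ N).const_mul (1 / (N : ℝ)))
    have hsum := sum_cellCost_medianPoints μ N
    -- Convergence comes from finiteness of the cell costs at the medians.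
    have hint := (lintegral_ofReal_ne_top_iff_integrable hmeas.aestronglyMeasurable
      (.of_forall hnonneg)).1
      (hsum ▸ ENNReal.sum_ne_top.2 fun i _ => cellCost_ne_top μ le_rfl hμ i _)
    refine ⟨hopt, ?_, ?_, ?_⟩
    · simpa using hform _ hopt
    · simpa [hN0.ne'] using hint.const_mul (N : ℝ)
    · rw [minError_eq μ le_rfl hμ hN hopt, hsum, one_div_one, ENNReal.rpow_one,
        ← integral_const_mul, integral_eq_lintegral_of_nonneg_ae (.of_forall hnonneg)
          hmeas.aestronglyMeasurable]
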